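/- Let $(\Omega,P)$ be a probability space, and for a measurable $f:\Omega\to[0,1]$ write $Pf=\int f\,dP$. For a class $\mathcal C$ of subsets of a set $X$ let $S(j)=\max_{x\in X^j}\bigl|\{\{x_1,\dots,x_j\}\cap C: C\in\mathcal C\}\bigr|$, and let the VC dimension of $\mathcal C$ be $\inf\{j\ge 1: S(j)<2^j\}$; $\mathcal C$ is a VC class if this is finite. A class $\mathcal F$ of functions on $\Omega$ is called VC-subgraph, of VC dimension $d$, if the class of sets $\bigl\{\{(\omega,t)\in\Omega\times\mathbb R: t\le f(\omega)\}: f\in\mathcal F\bigr\}$ is a VC class of VC dimension $d$. There is an absolute constant $K>0$ such that the following holds. Let $(\Omega,P)$ be any probability space and let $\mathcal F$ be any VC-subgraph class of measurable functions $f:\Omega\to[0,1]$ with VC dimension $d<\infty$. Assume that $\mathcal F$ is a $P$-measurable class, that is, for all $m$ and all $e\in\mathbb R^m$ the function $(x_1,\dots,x_m)\mapsto\sup_{f\in\mathcal F}\sum_{i=1}^m e_i f(x_i)$ is measurable on the completion of the product space $(\Omega^m,P^m)$ (this is automatic if, for example, $\mathcal F$ is countable, or $\Omega$ is finite with all its points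 measurable). Then for every integer $n\ge 2$ and every $\delta>0$, with $P^n$-probability at least $1-\delta$ over $x=(x_1,\dots,x_n)\in\Omega^n$, every $f\in\mathcal F$ satisfies $$\frac{1}{n\,(Pf)^{1/2}}\sum_{i=1}^n\bigl(Pf-f(x_i)\bigr)\le K\left(\Bigl(\frac dn\log n\Bigr)^{1/2}+\Bigl(\frac1n\log\frac1\delta\Bigr)^{1/2}\right).$$ Here the left-hand side is read as $0$ when $Pf=0$, and "with probability at least $1-\delta$" means that the inequality holds for all $f\in\mathcal F$ on some measurable event of probability at least $1-\delta$ (for $\delta\ge 1$ this is no condition). -/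

import Mathlib

open MeasureTheory

/-- The growth function `S(n)` of a class `C` of subsets of `X`: the largest number of distinct
traces `{x₁, …, xₙ} ∩ A`, `A ∈ C`, over all choices of `x₁, …, xₙ ∈ X`. -/
noncomputable def growthFunction {X : Type*} (C : Set (Set X)) (n : ℕ) : ℕ∞ :=
  ⨆ x : Fin n → X, ((fun A : Set X => Set.range x ∩ A) '' C).encard

/-- The VC dimension `inf {j ≥ 1 : S(j) < 2 ^ j}` of a class of sets; it is `⊤` if there is no
such `j`, and the class is a VC class exactly when it is finite. -/
noncomputable def vcDimension {X : Type*} (C : Set (Set X)) : ℕ∞ :=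
  sInf {k : ℕ∞ | ∃ j : ℕ, k = (j : ℕ∞) ∧ 1 ≤ j ∧ growthFunction C j < 2 ^ j}

/-- The class of the subgraphs `{(ω, t) : t ≤ f ω}`, `f ∈ F`, in `Ω × ℝ`. -/
def subgraphClass {Ω : Type*} (F : Set (Ω → ℝ)) : Set (Set (Ω × ℝ)) :=
  (fun f : Ω → ℝ => {p : Ω × ℝ | p.2 ≤ f p.1}) '' F

/-- `F` is VC-subgraph with VC dimension the (finite) number `d`. -/
def IsVCSubgraph {Ω : Type*} (F : Set (Ω → ℝ)) (d : ℕ) : Prop :=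
  vcDimension (subgraphClass F) = (d : ℕ∞)

/-- `F` is a `P`-measurable class: for all `m` and all weights `e₁, …, eₘ` the supremum
`sup_{f ∈ F} (e₁ f(x₁) + ⋯ + eₘ f(xₘ))` is a measurable function on the completion of the
product space `(Ωᵐ, Pᵐ)`. (For real functions this is the same as `AEMeasurable`.) -/
def IsMeasurableClass {Ω : Type*} [MeasurableSpace Ω] (P : Measure Ω) (F : Set (Ω → ℝ)) : Prop :=
  ∀ (m : ℕ) (e : Fin m → ℝ),
    AEMeasurable (fun x : Fin m → Ω => ⨆ f : F, ∑ i, e i * f.1 (x i))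
      (Measure.pi fun _ : Fin m => P)

/-! The proof is a ghost-sample symmetrization with self-normalized deviations. If `n Pf - ∑ f(xᵢ)`
exceeds `H √(n Pf)`, an independent sample `y` has `∑ f(yᵢ)` near `n Pf` with probability at least
1/2, since for `[0,1]`-valued `f` the variance is at most the mean. Then `∑ (f(yᵢ) - f(xᵢ))` exceeds
`(H/2) √(∑ (f(xᵢ) + f(yᵢ)))` (`ghost_deviation`, `exists_measurableSet_deviation`).

Exchanging `xᵢ` and `yᵢ` preserves the product measure, so it suffices to count the bad sign
patterns of a fixed double sample. The radicand is swap-invariant and dominates `∑ (f(yᵢ) -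
f(xᵢ))²`, so a Rademacher tail bound applies to each function. Rounding values to the grid of step
`1/n` leaves at most `(2n² + 1)^d` patterns by Sauer–Shelah on the subgraphs, and a union bound
finishes (`card_swap_mem_ghostBad_le`). -/

/-! ### Tail bounds for Rademacher sums. -/

/-- The sign attached to a boolean: `-1` for `true`, `1` for `false`. -/
def boolSign (b : Bool) : ℝ := if b then -1 else 1

lemma sum_exp_boolSign_le {κ : Type*} [Fintype κ] [DecidableEq κ] (c : κ → ℝ) (l : ℝ) :
    ∑ σ : κ → Bool, Real.exp (l * ∑ i, boolSign (σ i) * c i) ≤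
      2 ^ Fintype.card κ * Real.exp (l ^ 2 * (∑ i, c i ^ 2) / 2) := by
  have h1 : ∑ σ : κ → Bool, Real.exp (l * ∑ i, boolSign (σ i) * c i) =
      ∏ i, (2 * Real.cosh (l * c i)) := by
    calc _ = ∑ σ : κ → Bool, ∏ i, Real.exp (l * (boolSign (σ i) * c i)) := by
          simp only [Finset.mul_sum, Real.exp_sum]
      _ = ∏ i, ∑ b : Bool, Real.exp (l * (boolSign b * c i)) := by
          rw [Finset.prod_univ_sum, Fintype.piFinset_univ]
      _ = _ := by
          refine Finset.prod_congr rfl fun i _ => ?_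
          rw [Fintype.sum_bool, Real.cosh_eq]
          simp only [boolSign]
          norm_num
          ring
  rw [h1, Finset.prod_mul_distrib, Finset.prod_const, Finset.card_univ]
  gcongr
  calc ∏ i, Real.cosh (l * c i) ≤ ∏ i, Real.exp ((l * c i) ^ 2 / 2) :=
        Finset.prod_le_prod (fun i _ => (Real.cosh_pos _).le)
          (fun i _ => Real.cosh_le_exp_half_sq _)
    _ = _ := by
        rw [← Real.exp_sum, Finset.mul_sum, Finset.sum_div]
        simp only [mul_pow]

/-- A subgaussian tail bound for Rademacher sums, in counting form. -/
lemma card_rademacher_tail_le {κ : Type*} [Fintype κ] [DecidableEq κ] (c : κ → ℝ) {V t : ℝ}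
    (hV : ∑ i, c i ^ 2 ≤ V) (ht : 0 ≤ t) :
    ((Finset.univ.filter fun σ : κ → Bool =>
        t * √V < ∑ i, boolSign (σ i) * c i).card : ℝ) ≤
      2 ^ Fintype.card κ * Real.exp (-t ^ 2 / 2) := by
  have hV0 : 0 ≤ V := (Finset.sum_nonneg fun i _ => sq_nonneg (c i)).trans hV
  rcases hV0.eq_or_lt with h0 | hpos
  · have hc : ∀ i, c i = 0 := fun i => by
      have := Finset.single_le_sum (f := fun i => c i ^ 2) (fun i _ => sq_nonneg (c i))
        (Finset.mem_univ i)
      have h2 : c i ^ 2 ≤ 0 := by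
        linarith
      exact pow_eq_zero_iff two_ne_zero |>.1 (le_antisymm h2 (sq_nonneg _))
    simp only [hc, ← h0]
    simp
    positivity
  · have hs : 0 < √V := Real.sqrt_pos.2 hpos
    -- This `l` minimizes the Chernoff exponent `l² V / 2 - l t √V`.
    set l := t / √V with hl
    have hl0 : 0 ≤ l := by positivity
    have h2 : l * (t * √V) = t ^ 2 := by rw [hl]; field_simp
    have h3 : l ^ 2 * V = t ^ 2 := by rw [hl, div_pow, Real.sq_sqrt hV0]; field_simp
    have key : ((Finset.univ.filter fun σ : κ → Bool =>
        t * √V < ∑ i, boolSign (σ i) * c i).card : ℝ) * Real.exp (t ^ 2) ≤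
          2 ^ Fintype.card κ * Real.exp (t ^ 2 / 2) := by
      calc _ = ∑ σ ∈ Finset.univ.filter (fun σ : κ → Bool =>
            t * √V < ∑ i, boolSign (σ i) * c i), Real.exp (t ^ 2) := by simp
        _ ≤ ∑ σ ∈ Finset.univ.filter (fun σ : κ → Bool =>
            t * √V < ∑ i, boolSign (σ i) * c i),
              Real.exp (l * ∑ i, boolSign (σ i) * c i) := by
            refine Finset.sum_le_sum fun σ hσ => Real.exp_le_exp.2 ?_
            rw [← h2]
            exact mul_le_mul_of_nonneg_left (Finset.mem_filter.1 hσ).2.le hl0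
        _ ≤ ∑ σ : κ → Bool, Real.exp (l * ∑ i, boolSign (σ i) * c i) :=
            Finset.sum_le_sum_of_subset_of_nonneg (Finset.subset_univ _)
              fun _ _ _ => (Real.exp_pos _).le
        _ ≤ 2 ^ Fintype.card κ * Real.exp (l ^ 2 * (∑ i, c i ^ 2) / 2) :=
            sum_exp_boolSign_le c l
        _ ≤ _ := by
            rw [← h3]
            gcongr
    have h4 : Real.exp (t ^ 2 / 2) = Real.exp (-t ^ 2 / 2) * Real.exp (t ^ 2) := by
      rw [← Real.exp_add]; ring_nf
    rw [h4, ← mul_assoc] at key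
    exact le_of_mul_le_mul_right key (Real.exp_pos _)

/-! ### VC dimension and the number of traces. -/

lemma growthFunction_lt_of_vcDimension_eq {X : Type*} {C : Set (Set X)} {d : ℕ}
    (h : vcDimension C = (d : ℕ∞)) : growthFunction C d < 2 ^ d := by
  have hne : {k : ℕ∞ | ∃ j : ℕ, k = (j : ℕ∞) ∧ 1 ≤ j ∧ growthFunction C j < 2 ^ j}.Nonempty := by
    by_contra hcon
    rw [Set.not_nonempty_iff_eq_empty] at hcon
    rw [vcDimension, hcon, sInf_empty] at h
    exact ENat.top_ne_natCast d h
  obtain ⟨j, hj, -, hlt⟩ := csInf_mem hne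
  have : (d : ℕ∞) = j := by rw [← h, ← hj, vcDimension]
  rw [Nat.cast_inj] at this
  rwa [this]

lemma one_le_of_vcDimension_eq {X : Type*} {C : Set (Set X)} {d : ℕ}
    (h : vcDimension C = (d : ℕ∞)) : 1 ≤ d := by
  have : (1 : ℕ∞) ≤ vcDimension C := by
    refine le_sInf ?_
    rintro k ⟨j, rfl, hj, -⟩
    exact_mod_cast hj
  rw [h] at this
  exact_mod_cast this

lemma sum_choose_le_pow (N d : ℕ) : ∑ k ∈ Finset.Iic d, N.choose k ≤ (N + 1) ^ d := by
  rw [add_pow]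
  have : Finset.Iic d = Finset.range (d + 1) := by ext; simp
  rw [this]
  refine Finset.sum_le_sum fun k hk => ?_
  have h1 : 0 < d.choose k := Nat.choose_pos (Nat.lt_succ_iff.1 (Finset.mem_range.1 hk))
  calc N.choose k ≤ N ^ k := Nat.choose_le_pow N k
    _ ≤ _ := by
      rw [one_pow, mul_one]
      exact Nat.le_mul_of_pos_right _ h1

open Classical in
/-- The traces of a class of sets on a finite family of points, as sets of indices. -/
noncomputable def traceFamily {X ι : Type*} [Fintype ι] (C : Set (Set X)) (p : ι → X) :
    Finset (Finset ι) :=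
  Finset.univ.filter fun s => ∃ A ∈ C, s = Finset.univ.filter fun i => p i ∈ A

-- Sauer–Shelah. Here `d` is the least size that is not always shattered, one above the convention
-- of `Finset.vcDim`; the bound `vcDim ≤ d` is therefore not sharp, but it suffices.
open Classical in
lemma card_traceFamily_le {X ι : Type*} [Fintype ι] {C : Set (Set X)} {d : ℕ}
    (h : vcDimension C = (d : ℕ∞)) (p : ι → X) :
    (traceFamily C p).card ≤ (Fintype.card ι + 1) ^ d := by
  have hdim : (traceFamily C p).vcDim ≤ d := by
    refine Finset.sup_le fun s hs => ?_
    rw [Finset.mem_shatterer] at hs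
    by_contra! hcard
    obtain ⟨t, hts, htd⟩ := Finset.exists_subset_card_eq hcard.le
    have ht := hs.mono_right hts
    have hlt := growthFunction_lt_of_vcDimension_eq h
    let e : Fin d ≃ t := (Finset.equivFinOfCardEq htd).symm
    let x : Fin d → X := fun j => p (e j)
    have hle : ((fun A : Set X => Set.range x ∩ A) '' C).encard ≤ growthFunction C d :=
      le_iSup (fun x : Fin d → X => ((fun A : Set X => Set.range x ∩ A) '' C).encard) x
    have hpow : (2 ^ d : ℕ∞) ≤ ((fun A : Set X => Set.range x ∩ A) '' C).encard := by
      have h1 : ((t.powerset : Finset (Finset ι)) : Set (Finset ι)).encard = 2 ^ d := by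
        rw [Set.encard_coe_eq_coe_finsetCard, Finset.card_powerset, htd]
        norm_cast
      rw [← h1]
      -- Pulling traces in `X` back to indices is a map whose image contains every subset of `t`, so
      -- there are at least `2 ^ d` traces.
      refine (Set.encard_le_encard (t := (fun B : Set X => t.filter fun i => p i ∈ B) ''
        ((fun A : Set X => Set.range x ∩ A) '' C)) ?_).trans (Set.encard_image_le _ _)
      intro u hu
      obtain ⟨v, hv, hvu⟩ := ht (Finset.mem_powerset.1 (Finset.mem_coe.1 hu))
      obtain ⟨A, hA, rfl⟩ := (Finset.mem_filter.1 hv).2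
      refine ⟨_, ⟨A, hA, rfl⟩, ?_⟩
      rw [← hvu]
      ext i
      simp only [Finset.mem_filter, Set.mem_inter_iff, Finset.mem_inter, Finset.mem_univ, true_and]
      constructor
      · rintro ⟨hi, -, hi'⟩
        exact ⟨hi, hi'⟩
      · rintro ⟨hi, hi'⟩
        exact ⟨hi, ⟨e.symm ⟨i, hi⟩, by simp [x]⟩, hi'⟩
    exact absurd (hpow.trans hle) (not_le.2 hlt)
  calc (traceFamily C p).card ≤ (traceFamily C p).shatterer.card :=
        Finset.card_le_card_shatterer _
    _ ≤ ∑ k ∈ Finset.Iic (traceFamily C p).vcDim, (Fintype.card ι).choose k :=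
        Finset.card_shatterer_le_sum_vcDim
    _ ≤ ∑ k ∈ Finset.Iic d, (Fintype.card ι).choose k :=
        Finset.sum_le_sum_of_subset (Finset.Iic_subset_Iic.2 hdim)
    _ ≤ _ := sum_choose_le_pow _ _

/-! ### Discretization, and sign patterns of a fixed double sample. -/

/-- The count is `⌊n t⌋`: rounding down to the grid loses at most `1/n`. -/
lemma card_filter_grid_le {n : ℕ} {t : ℝ} (h0 : 0 ≤ t) (h1 : t ≤ 1) :
    (((Finset.univ.filter fun k : Fin n => ((k : ℝ) + 1) / n ≤ t).card : ℕ) : ℝ) / n ≤ t ∧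
      (0 < n → t ≤ ((Finset.univ.filter fun k : Fin n => ((k : ℝ) + 1) / n ≤ t).card : ℝ) / n
        + 1 / n) := by
  rcases Nat.eq_zero_or_pos n with rfl | hn
  · simpa using h0
  have hn' : (0 : ℝ) < n := Nat.cast_pos.2 hn
  have hcard : (Finset.univ.filter fun k : Fin n => ((k : ℝ) + 1) / n ≤ t).card = ⌊n * t⌋₊ := by
    have hfl : ⌊n * t⌋₊ ≤ n := by
      refine Nat.floor_le_of_le ?_
      nlinarith
    have : (Finset.univ.filter fun k : Fin n => ((k : ℝ) + 1) / n ≤ t) =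
        Finset.univ.filter fun k : Fin n => (k : ℕ) < ⌊n * t⌋₊ := by
      ext k
      simp only [Finset.mem_filter, Finset.mem_univ, true_and]
      rw [div_le_iff₀ hn', Nat.lt_iff_add_one_le, Nat.le_floor_iff (by positivity)]
      push_cast
      rw [mul_comm]
    rw [this, Fin.card_filter_val_lt, min_eq_right hfl]
  rw [hcard]
  refine ⟨?_, fun _ => ?_⟩
  · rw [div_le_iff₀ hn', mul_comm]
    exact Nat.floor_le (by positivity)
  · rw [← add_div, le_div_iff₀ hn', mul_comm]
    exact (Nat.lt_floor_add_one _).le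

/-- The coordinates `i` with `σ i = true` are exchanged between a sample and its ghost copy. -/
def swapEquiv {κ : Type*} (σ : κ → Bool) : κ ⊕ κ ≃ κ ⊕ κ where
  toFun := Sum.elim (fun i => if σ i then .inr i else .inl i)
    (fun i => if σ i then .inl i else .inr i)
  invFun := Sum.elim (fun i => if σ i then .inr i else .inl i)
    (fun i => if σ i then .inl i else .inr i)
  left_inv := by rintro (i | i) <;> by_cases h : σ i <;> simp [h]
  right_inv := by rintro (i | i) <;> by_cases h : σ i <;> simp [h]

/-- The double samples `(x, y)`, indexed by `κ ⊕ κ`, on which some `f ∈ F` has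
`∑ (f (y i) - f (x i)) > t * √(∑ (f (x i) + f (y i)))`. -/
def ghostBad {Ω κ : Type*} [Fintype κ] (F : Set (Ω → ℝ)) (t : ℝ) : Set (κ ⊕ κ → Ω) :=
  {z | ∃ f ∈ F, t * √(∑ i, (f (z (.inl i)) + f (z (.inr i)))) <
    ∑ i, (f (z (.inr i)) - f (z (.inl i)))}

lemma comp_swapEquiv_mem_ghostBad {Ω κ : Type*} [Fintype κ] {F : Set (Ω → ℝ)} {t : ℝ}
    {z : κ ⊕ κ → Ω} {σ : κ → Bool} :
    z ∘ swapEquiv σ ∈ ghostBad F t ↔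
      ∃ f ∈ F, t * √(∑ i, (f (z (.inl i)) + f (z (.inr i)))) <
        ∑ i, boolSign (σ i) * (f (z (.inr i)) - f (z (.inl i))) := by
  refine exists_congr fun f => and_congr_right fun _ => ?_
  have h1 : ∀ i, f ((z ∘ swapEquiv σ) (.inl i)) + f ((z ∘ swapEquiv σ) (.inr i)) =
      f (z (.inl i)) + f (z (.inr i)) := fun i => by
    by_cases h : σ i <;> simp [swapEquiv, h, add_comm]
  have h2 : ∀ i, f ((z ∘ swapEquiv σ) (.inr i)) - f ((z ∘ swapEquiv σ) (.inl i)) =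
      boolSign (σ i) * (f (z (.inr i)) - f (z (.inl i))) := fun i => by
    by_cases h : σ i <;> simp [swapEquiv, boolSign, h]
  simp only [h1, h2]

open Classical in
/-- The lower discretization of a function with the given grid pattern. -/
noncomputable def gridValue {ι : Type*} {n : ℕ} (s : Finset (ι × Fin n)) (j : ι) : ℝ :=
  ((Finset.univ.filter fun k : Fin n => (j, k) ∈ s).card : ℝ) / n

lemma gridValue_nonneg {ι : Type*} {n : ℕ} (s : Finset (ι × Fin n)) (j : ι) :
    0 ≤ gridValue s j := by unfold gridValue; positivity

lemma gridValue_le_one {ι : Type*} {n : ℕ} (s : Finset (ι × Fin n)) (j : ι) :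
    gridValue s j ≤ 1 := by
  classical
  unfold gridValue
  refine div_le_one_of_le₀ ?_ (Nat.cast_nonneg n)
  exact_mod_cast (Finset.card_le_univ _).trans (by simp)

open Classical in
/-- A fixed double sample is bad after few of the swaps. -/
lemma card_swap_mem_ghostBad_le {Ω : Type*} {F : Set (Ω → ℝ)} {d : ℕ} {n : ℕ} (hn : 0 < n)
    (hF : ∀ f ∈ F, ∀ ω, f ω ∈ Set.Icc (0 : ℝ) 1) (hd : IsVCSubgraph F d)
    {t : ℝ} (ht : 0 ≤ t) (ht2 : 2 ≤ t ^ 2) (z : Fin n ⊕ Fin n → Ω) :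
    ((Finset.univ.filter fun σ : Fin n → Bool => z ∘ swapEquiv σ ∈ ghostBad F t).card : ℝ) ≤
      (2 * n ^ 2 + 1) ^ d * (2 ^ n * Real.exp (-t ^ 2 / 8)) := by
  -- These `2n²` points form a grid over the double sample; which of them lie in the subgraph of `f`
  -- determines `f` rounded down at each sample point.
  let p : (Fin n ⊕ Fin n) × Fin n → Ω × ℝ := fun j => (z j.1, ((j.2 : ℝ) + 1) / n)
  let 𝒜 := traceFamily (subgraphClass F) p
  let B : Finset ((Fin n ⊕ Fin n) × Fin n) → Finset (Fin n → Bool) := fun s =>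
    Finset.univ.filter fun σ => t / 2 * √(∑ i, (gridValue s (.inl i) + gridValue s (.inr i))) <
      ∑ i, boolSign (σ i) * (gridValue s (.inr i) - gridValue s (.inl i))
  have hn' : (0 : ℝ) < n := Nat.cast_pos.2 hn
  have hsub : (Finset.univ.filter fun σ : Fin n → Bool => z ∘ swapEquiv σ ∈ ghostBad F t) ⊆
      𝒜.biUnion B := by
    intro σ hσ
    obtain ⟨f, hf, hlt⟩ := comp_swapEquiv_mem_ghostBad.1 (Finset.mem_filter.1 hσ).2
    let s : Finset ((Fin n ⊕ Fin n) × Fin n) :=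
      Finset.univ.filter fun j => p j ∈ {q : Ω × ℝ | q.2 ≤ f q.1}
    have hs : s ∈ 𝒜 := Finset.mem_filter.2 ⟨Finset.mem_univ _, _, ⟨f, hf, rfl⟩, rfl⟩
    have hg : ∀ j, gridValue s j ≤ f (z j) ∧ f (z j) ≤ gridValue s j + 1 / n := fun j => by
      have h := card_filter_grid_le (n := n) (hF f hf (z j)).1 (hF f hf (z j)).2
      have heq : gridValue s j =
          ((Finset.univ.filter fun k : Fin n => ((k : ℝ) + 1) / n ≤ f (z j)).card : ℝ) / n := by
        unfold gridValue
        congr 3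
        ext k
        simp [s, p]
      rw [heq]
      exact ⟨h.1, h.2 hn⟩
    refine Finset.mem_biUnion.2 ⟨s, hs, Finset.mem_filter.2 ⟨Finset.mem_univ _, ?_⟩⟩
    set S := ∑ i, (f (z (.inl i)) + f (z (.inr i))) with hS
    set D := ∑ i, boolSign (σ i) * (f (z (.inr i)) - f (z (.inl i))) with hD
    have hDS : D ≤ S := Finset.sum_le_sum fun i _ => by
      have h1 := (hF f hf (z (.inl i))).1
      have h2 := (hF f hf (z (.inr i))).1
      cases σ i <;> simp [boolSign] <;> linarith
    have hS0 : 0 < S := by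
      have : 0 ≤ t * √S := by positivity
      linarith
    have hr : 0 < √S := Real.sqrt_pos.2 hS0
    have htr : t < √S := by
      have : t * √S < √S * √S := by rw [Real.mul_self_sqrt hS0.le]; linarith
      exact lt_of_mul_lt_mul_right this hr.le
    -- Rounding costs at most 1 in `D` and only lowers `S`. As `t √S ≥ 2`, half of the threshold
    -- pays for it, which is why `B` uses `t / 2`.
    have h2 : 2 ≤ t * √S := by nlinarith
    have hSg : √(∑ i, (gridValue s (.inl i) + gridValue s (.inr i))) ≤ √S :=
      Real.sqrt_le_sqrt (Finset.sum_le_sum fun i _ => add_le_add (hg _).1 (hg _).1)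
    have hDg : D - 1 ≤ ∑ i, boolSign (σ i) * (gridValue s (.inr i) - gridValue s (.inl i)) := by
      have h1 : (1 : ℝ) = ∑ _i : Fin n, (1 : ℝ) / n := by simp; field_simp
      rw [h1, hD, ← Finset.sum_sub_distrib]
      refine Finset.sum_le_sum fun i _ => ?_
      have h1 := hg (.inl i)
      have h2 := hg (.inr i)
      cases σ i <;> simp [boolSign] at h1 h2 ⊢ <;> linarith
    nlinarith
  have hB : ∀ s ∈ 𝒜, ((B s).card : ℝ) ≤ 2 ^ n * Real.exp (-t ^ 2 / 8) := fun s _ => by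
    have := card_rademacher_tail_le (fun i : Fin n => gridValue s (.inr i) - gridValue s (.inl i))
      (V := ∑ i, (gridValue s (.inl i) + gridValue s (.inr i))) (t := t / 2)
      -- For `a, b ∈ [0,1]`, `(b - a)² ≤ a + b`: the normalizing sum is a variance proxy.
      (Finset.sum_le_sum fun i _ => by
        have h1 := gridValue_nonneg s (.inl i)
        have h2 := gridValue_nonneg s (.inr i)
        have h3 := gridValue_le_one s (.inl i)
        have h4 := gridValue_le_one s (.inr i)
        nlinarith [mul_nonneg h1 h2]) (by positivity)
    rw [Fintype.card_fin] at this
    convert this using 3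
    ring
  have h𝒜 : (𝒜.card : ℝ) ≤ (2 * n ^ 2 + 1) ^ d := by
    have := card_traceFamily_le hd p
    have h2 : Fintype.card ((Fin n ⊕ Fin n) × Fin n) = 2 * n ^ 2 := by simp; ring
    rw [h2] at this
    exact_mod_cast this
  calc ((Finset.univ.filter fun σ : Fin n → Bool =>
        z ∘ swapEquiv σ ∈ ghostBad F t).card : ℝ) ≤ ((𝒜.biUnion B).card : ℝ) := by
        exact_mod_cast Finset.card_le_card hsub
    _ ≤ ∑ s ∈ 𝒜, ((B s).card : ℝ) := by exact_mod_cast Finset.card_biUnion_le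
    _ ≤ 𝒜.card * (2 ^ n * Real.exp (-t ^ 2 / 8)) := by
        rw [← nsmul_eq_mul]; exact Finset.sum_le_card_nsmul _ _ _ hB
    _ ≤ _ := by gcongr

/-! ### Measurability of the ghost event. -/

/-- By AM-GM, `√S` is the minimum of `q S + 1/(4q)` over `q > 0`, attained at `q = 1/(2√S)`;
continuity allows rational `q`. This makes the condition linear in `f`, so that measurability of
suprema of linear combinations applies. -/
lemma exists_rat_mul_sqrt_lt {t S D : ℝ} (ht : 0 < t) (hS : 0 ≤ S) (hDS : D ≤ S) :
    t * √S < D ↔ ∃ q : ℚ, 0 < (q : ℝ) ∧ t * (q * S + 1 / (4 * q)) < D := by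
  constructor
  · intro h
    have hS0 : 0 < S := by
      have : 0 ≤ t * √S := by positivity
      linarith
    have hr : 0 < √S := Real.sqrt_pos.2 hS0
    have hq0 : 0 < 1 / (2 * √S) := by positivity
    have hval : t * (1 / (2 * √S) * S + 1 / (4 * (1 / (2 * √S)))) < D := by
      convert h using 2
      have : S = √S * √S := (Real.mul_self_sqrt hS).symm
      field_simp
      rw [Real.sq_sqrt hS]
      ring
    have hcont : ContinuousAt (fun q : ℝ => t * (q * S + 1 / (4 * q))) (1 / (2 * √S)) := by
      refine ContinuousAt.mul continuousAt_const (ContinuousAt.add (by fun_prop) ?_)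
      exact ContinuousAt.div continuousAt_const (by fun_prop) (by positivity)
    have hev := (hcont.eventually_lt_const hval).and (lt_mem_nhds hq0)
    obtain ⟨q, hq⟩ := (Rat.denseRange_cast (𝕜 := ℝ)).exists_mem_open isOpen_interior
      ⟨_, mem_interior_iff_mem_nhds.2 hev⟩
    have := interior_subset hq
    exact ⟨q, this.2, this.1⟩
  · rintro ⟨q, hq, h⟩
    refine lt_of_le_of_lt (mul_le_mul_of_nonneg_left ?_ ht.le) h
    have h4 : (q : ℝ) * S + 1 / (4 * q) - √S = (2 * q * √S - 1) ^ 2 / (4 * q) := by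
      have : S = √S * √S := (Real.mul_self_sqrt hS).symm
      field_simp
      nlinarith
    have : 0 ≤ (2 * q * √S - 1) ^ 2 / (4 * q) := by positivity
    linarith

lemma aemeasurable_iSup_of_fintype {Ω : Type*} [MeasurableSpace Ω] {P : Measure Ω}
    [SigmaFinite P] {F : Set (Ω → ℝ)} (hF : IsMeasurableClass P F) {ι : Type*} [Fintype ι]
    (e : ι → ℝ) :
    AEMeasurable (fun z : ι → Ω => ⨆ f : F, ∑ i, e i * f.1 (z i)) (Measure.pi fun _ : ι => P) := by
  let φ := Fintype.equivFin ι
  have hmp := measurePreserving_piCongrLeft (fun _ : Fin (Fintype.card ι) => P) φ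
  have := (hF _ (e ∘ φ.symm)).comp_quasiMeasurePreserving hmp.quasiMeasurePreserving
  refine this.congr (Filter.Eventually.of_forall fun z => ?_)
  refine iSup_congr fun f => ?_
  refine (Fintype.sum_equiv φ _ _ fun i => ?_).symm
  have h : (MeasurableEquiv.piCongrLeft (fun _ : Fin (Fintype.card ι) => Ω) φ) z (φ i) = z i :=
    Equiv.piCongrLeft_apply_apply _ _ _ _
  rw [h]
  simp

lemma nullMeasurableSet_ghostBad {Ω : Type*} [MeasurableSpace Ω] {P : Measure Ω}
    [SigmaFinite P] {F : Set (Ω → ℝ)} (hF : ∀ f ∈ F, ∀ ω, f ω ∈ Set.Icc (0 : ℝ) 1)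
    (hP : IsMeasurableClass P F) {κ : Type*} [Fintype κ] {t : ℝ} (ht : 0 < t) :
    NullMeasurableSet (ghostBad F t : Set (κ ⊕ κ → Ω)) (Measure.pi fun _ => P) := by
  rcases F.eq_empty_or_nonempty with rfl | hne
  · simp [ghostBad]
  have : Nonempty F := hne.to_subtype
  -- The coefficients of `∑ (f(yᵢ) - f(xᵢ)) - t q ∑ (f(xᵢ) + f(yᵢ))`.
  let e : ℚ → κ ⊕ κ → ℝ := fun q => Sum.elim (fun _ => -(1 + t * q)) (fun _ => 1 - t * q)
  have heq : (ghostBad F t : Set (κ ⊕ κ → Ω)) = ⋃ q : ℚ, ⋃ _ : 0 < (q : ℝ),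
      {z | t / (4 * q) < ⨆ f : F, ∑ i, e q i * f.1 (z i)} := by
    ext z
    have hbdd : ∀ q, BddAbove (Set.range fun f : F => ∑ i, e q i * f.1 (z i)) := fun q => by
      refine ⟨∑ i, |e q i|, ?_⟩
      rintro _ ⟨f, rfl⟩
      refine Finset.sum_le_sum fun i _ => ?_
      have := hF f.1 f.2 (z i)
      calc e q i * f.1 (z i) ≤ |e q i| * f.1 (z i) :=
            mul_le_mul_of_nonneg_right (le_abs_self _) this.1
        _ ≤ |e q i| := mul_le_of_le_one_right (abs_nonneg _) this.2
    simp only [Set.mem_iUnion, Set.mem_ofPred_eq, exists_prop]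
    have hlin : ∀ (q : ℚ) (f : Ω → ℝ), 0 < (q : ℝ) →
        (t * (q * ∑ i, (f (z (.inl i)) + f (z (.inr i))) + 1 / (4 * q)) <
          ∑ i, (f (z (.inr i)) - f (z (.inl i))) ↔ t / (4 * q) < ∑ i, e q i * f (z i)) := by
      intro q f hq
      have : ∑ i, e q i * f (z i) = ∑ i, (f (z (.inr i)) - f (z (.inl i))) -
          t * (q * ∑ i, (f (z (.inl i)) + f (z (.inr i)))) := by
        rw [Fintype.sum_sum_type, Finset.mul_sum, Finset.mul_sum, ← Finset.sum_add_distrib,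
          ← Finset.sum_sub_distrib]
        refine Finset.sum_congr rfl fun i _ => ?_
        simp only [e, Sum.elim_inl, Sum.elim_inr]
        ring
      rw [this, mul_add, mul_one_div]
      constructor <;> intro h <;> linarith
    have hmem : ∀ f ∈ F, (t * √(∑ i, (f (z (.inl i)) + f (z (.inr i)))) <
        ∑ i, (f (z (.inr i)) - f (z (.inl i))) ↔
        ∃ q : ℚ, 0 < (q : ℝ) ∧ t / (4 * q) < ∑ i, e q i * f (z i)) := by
      intro f hf
      rw [exists_rat_mul_sqrt_lt ht]
      · exact exists_congr fun q => and_congr_right fun hq => hlin q f hq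
      · exact Finset.sum_nonneg fun i _ => add_nonneg (hF f hf _).1 (hF f hf _).1
      · refine Finset.sum_le_sum fun i _ => ?_
        have := (hF f hf (z (.inl i))).1
        linarith
    constructor
    · rintro ⟨f, hf, h⟩
      obtain ⟨q, hq, h⟩ := (hmem f hf).1 h
      exact ⟨q, hq, (lt_ciSup_iff (hbdd q)).2 ⟨⟨f, hf⟩, h⟩⟩
    · rintro ⟨q, hq, h⟩
      obtain ⟨f, h⟩ := (lt_ciSup_iff (hbdd q)).1 h
      exact ⟨f.1, f.2, (hmem f.1 f.2).2 ⟨q, hq, h⟩⟩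
  rw [heq]
  refine NullMeasurableSet.iUnion fun q => NullMeasurableSet.iUnion fun _ => ?_
  exact nullMeasurableSet_lt aemeasurable_const (aemeasurable_iSup_of_fintype hP (e q))

/-! ### Averaging over the swaps. -/

open Classical in
/-- If every point lies in few of the preimages of `B` under a finite family of measure
preserving maps, then `B` has small measure. -/
lemma card_mul_measure_le_of_measurePreserving {α S : Type*} [MeasurableSpace α] [Fintype S]
    {μ : Measure α} [IsProbabilityMeasure μ] {B : Set α} (hB : NullMeasurableSet B μ)
    {T : S → α → α} (hT : ∀ s, MeasurePreserving (T s) μ μ) {c : ℝ}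
    (hc : ∀ z, ((Finset.univ.filter fun s => T s z ∈ B).card : ℝ) ≤ c) :
    (Fintype.card S : ENNReal) * μ B ≤ ENNReal.ofReal c := by
  have hnull : ∀ s, NullMeasurableSet (T s ⁻¹' B) μ := fun s =>
    hB.preimage (hT s).quasiMeasurePreserving
  calc (Fintype.card S : ENNReal) * μ B = ∑ s : S, μ (T s ⁻¹' B) := by
        simp [(hT _).measure_preimage hB]
    _ = ∑ s : S, ∫⁻ z, (T s ⁻¹' B).indicator 1 z ∂μ := by
        simp only [lintegral_indicator_one₀ (hnull _)]
    _ = ∫⁻ z, ∑ s : S, (T s ⁻¹' B).indicator 1 z ∂μ :=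
        (lintegral_finsetSum' _ fun s _ => aemeasurable_one.indicator₀ (hnull s)).symm
    _ ≤ ∫⁻ _, ENNReal.ofReal c ∂μ := by
        refine lintegral_mono fun z => ?_
        have : ∑ s : S, (T s ⁻¹' B).indicator (1 : α → ENNReal) z =
            ((Finset.univ.filter fun s => T s z ∈ B).card : ENNReal) := by
          simp [Set.indicator_apply, Finset.sum_boole]
        rw [this, ← ENNReal.ofReal_natCast]
        exact ENNReal.ofReal_le_ofReal (hc z)
    _ = _ := by simp

lemma measurePreserving_comp_equiv {Ω ι : Type*} [MeasurableSpace Ω] [Fintype ι] (P : Measure Ω)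
    [SigmaFinite P] (e : ι ≃ ι) :
    MeasurePreserving (fun z : ι → Ω => z ∘ e) (Measure.pi fun _ => P)
      (Measure.pi fun _ => P) := by
  have h := measurePreserving_piCongrLeft (fun _ : ι => P) e.symm
  have heq : ⇑(MeasurableEquiv.piCongrLeft (fun _ : ι => Ω) e.symm) =
      fun z : ι → Ω => z ∘ e := by
    ext z i
    have := Equiv.piCongrLeft_apply_apply (fun _ : ι => Ω) e.symm z (e i)
    rw [Equiv.symm_apply_apply] at this
    exact this
  rwa [heq] at h

lemma measure_ghostBad_le {Ω : Type*} [MeasurableSpace Ω] {P : Measure Ω}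
    [IsProbabilityMeasure P] {F : Set (Ω → ℝ)} {d n : ℕ} (hn : 0 < n)
    (hF : ∀ f ∈ F, ∀ ω, f ω ∈ Set.Icc (0 : ℝ) 1) (hP : IsMeasurableClass P F)
    (hd : IsVCSubgraph F d) {t : ℝ} (ht : 0 < t) (ht2 : 2 ≤ t ^ 2) :
    (Measure.pi fun _ : Fin n ⊕ Fin n => P) (ghostBad F t) ≤
      ENNReal.ofReal ((2 * n ^ 2 + 1) ^ d * Real.exp (-t ^ 2 / 8)) := by
  classical
  have h := card_mul_measure_le_of_measurePreserving (nullMeasurableSet_ghostBad hF hP ht)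
    (fun σ : Fin n → Bool => measurePreserving_comp_equiv P (swapEquiv σ))
    (card_swap_mem_ghostBad_le hn hF hd ht.le ht2)
  have hcard : (Fintype.card (Fin n → Bool) : ENNReal) = ENNReal.ofReal (2 ^ n) := by
    rw [ENNReal.ofReal_pow (by norm_num)]
    simp
  rw [hcard, mul_left_comm, ENNReal.ofReal_mul (by positivity)] at h
  exact (ENNReal.mul_le_mul_iff_right (by simp) ENNReal.ofReal_ne_top).1 h

/-! ### Symmetrization. -/

/-- Chebyshev, with the variance of a `[0,1]`-valued `f` at most `p (1 - p) ≤ p`. -/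
lemma measure_sum_deviation_le {Ω : Type*} [MeasurableSpace Ω] {P : Measure Ω}
    [IsProbabilityMeasure P] {f : Ω → ℝ} (hf : Measurable f)
    (hf01 : ∀ ω, f ω ∈ Set.Icc (0 : ℝ) 1) {n : ℕ} {s : ℝ} (hs : 0 < s) :
    (Measure.pi fun _ : Fin n => P) {y | s ≤ |∑ i, f (y i) - n * ∫ ω, f ω ∂P|} ≤
      ENNReal.ofReal (n * (∫ ω, f ω ∂P) / s ^ 2) := by
  have hmem : MemLp f 2 P := by
    refine MemLp.of_bound hf.aestronglyMeasurable 1 (Filter.Eventually.of_forall fun ω => ?_)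
    rw [Real.norm_of_nonneg (hf01 ω).1]
    exact (hf01 ω).2
  have hint : Integrable f P := hmem.integrable (by norm_num)
  have hp0 : 0 ≤ ∫ ω, f ω ∂P := integral_nonneg fun ω => (hf01 ω).1
  have hvar : ProbabilityTheory.variance f P ≤ ∫ ω, f ω ∂P := by
    have := ProbabilityTheory.variance_le_sub_mul_sub (μ := P)
      (Filter.Eventually.of_forall hf01) hf.aemeasurable
    nlinarith
  have hmemi : ∀ i : Fin n, MemLp (fun y : Fin n → Ω => f (y i)) 2 (Measure.pi fun _ => P) :=
    fun i => hmem.comp_measurePreserving (measurePreserving_eval (fun _ => P) i)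
  have hexp : ∫ y, (∑ i : Fin n, fun y : Fin n → Ω => f (y i)) y ∂(Measure.pi fun _ => P) =
      n * ∫ ω, f ω ∂P := by
    simp only [Finset.sum_apply]
    rw [integral_finsetSum _ fun i _ => (hmemi i).integrable (by norm_num)]
    have : ∀ i : Fin n, ∫ y : Fin n → Ω, f (y i) ∂(Measure.pi fun _ => P) = ∫ ω, f ω ∂P :=
      fun i => integral_comp_eval (μ := fun _ => P) hf.aestronglyMeasurable
    simp [this]
  have hch := ProbabilityTheory.meas_ge_le_variance_div_sq
    (X := ∑ i : Fin n, fun y : Fin n → Ω => f (y i)) (memLp_finsetSum' _ fun i _ => hmemi i) hs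
  rw [hexp, ProbabilityTheory.variance_sum_pi (fun _ => hmem)] at hch
  simp only [Finset.sum_apply] at hch
  refine hch.trans (ENNReal.ofReal_le_ofReal ?_)
  gcongr
  calc _ ≤ ∑ _i : Fin n, ∫ ω, f ω ∂P := Finset.sum_le_sum fun i _ => hvar
    _ = _ := by simp

/-- Here `q = √(n Pf)`, and `a`, `b` are the sums over the sample and its ghost. The bounds give `b
- a > 3Hq/4` and `a + b < 2q² ≤ (3q/2)²`. -/
lemma ghost_deviation {H q a b : ℝ} (hH : 0 < H) (hq : 0 < q) (ha0 : 0 ≤ a)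
    (ha : a < q ^ 2 - H * q) (hb : |b - q ^ 2| < H * q / 4) : H / 2 * √(a + b) < b - a := by
  obtain ⟨h1, h2⟩ := abs_lt.1 hb
  have hS : √(a + b) ≤ 3 / 2 * q := by
    refine Real.sqrt_le_iff.2 ⟨by positivity, ?_⟩
    have := mul_pos hH hq
    nlinarith
  have := mul_le_mul_of_nonneg_left hS (by positivity : 0 ≤ H / 2)
  nlinarith

/-- Symmetrization: the event of a large weighted deviation is covered by a measurable set whose
measure is at most twice that of the ghost event. -/
lemma exists_measurableSet_deviation {Ω : Type*} [MeasurableSpace Ω] {P : Measure Ω}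
    [IsProbabilityMeasure P] {F : Set (Ω → ℝ)}
    (hF : ∀ f ∈ F, Measurable f ∧ ∀ ω, f ω ∈ Set.Icc (0 : ℝ) 1) {n : ℕ} {H : ℝ}
    (hH : 0 < H) (hH2 : 64 ≤ H ^ 2) :
    ∃ G : Set (Fin n → Ω), MeasurableSet G ∧
      (Measure.pi fun _ : Fin n => P) G ≤
        2 * (Measure.pi fun _ : Fin n ⊕ Fin n => P) (ghostBad F (H / 2)) ∧
      ∀ x ∉ G, ∀ f ∈ F, 0 < n * ∫ ω, f ω ∂P →
        n * (∫ ω, f ω ∂P) - H * √(n * ∫ ω, f ω ∂P) ≤ ∑ i, f (x i) := by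
  set μ := Measure.pi fun _ : Fin n => P with hμ
  let φ := MeasurableEquiv.sumPiEquivProdPi (fun _ : Fin n ⊕ Fin n => Ω)
  have hφ : MeasurePreserving φ.symm (μ.prod μ) (Measure.pi fun _ : Fin n ⊕ Fin n => P) :=
    measurePreserving_sumPiEquivProdPi_symm (fun _ : Fin n ⊕ Fin n => P)
  -- The ghost event is replaced by a measurable hull of equal measure, so that its sections have
  -- measurable mass.
  let A := φ.symm ⁻¹' toMeasurable (Measure.pi fun _ : Fin n ⊕ Fin n => P) (ghostBad F (H / 2))
  have hA : MeasurableSet A := hφ.measurable (measurableSet_toMeasurable _ _)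
  have hμA : (μ.prod μ) A = (Measure.pi fun _ : Fin n ⊕ Fin n => P) (ghostBad F (H / 2)) := by
    rw [hφ.measure_preimage (measurableSet_toMeasurable _ _).nullMeasurableSet,
      measure_toMeasurable]
  have hmeas : Measurable fun x => μ (Prod.mk x ⁻¹' A) := measurable_measure_prodMk_left hA
  -- `G` collects the `x` whose section of `A` has mass at least 1/2; Markov's inequality gives the
  -- factor 2.
  refine ⟨{x | 1 / 2 ≤ μ (Prod.mk x ⁻¹' A)}, measurableSet_le measurable_const hmeas, ?_, ?_⟩
  · rw [← hμA, Measure.prod_apply hA]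
    have := mul_meas_ge_le_lintegral (μ := μ) hmeas (1 / 2)
    calc _ = 2 * (1 / 2 * μ {x | 1 / 2 ≤ μ (Prod.mk x ⁻¹' A)}) := by
          rw [← mul_assoc, one_div, ENNReal.mul_inv_cancel (by norm_num) (by norm_num), one_mul]
      _ ≤ _ := by gcongr
  · intro x hx f hf hp
    by_contra! hlt
    refine hx ?_
    set p := ∫ ω, f ω ∂P
    set q := √(n * p) with hq
    have hq0 : 0 < q := Real.sqrt_pos.2 hp
    have hq2 : q ^ 2 = n * p := Real.sq_sqrt hp.le
    set D := {y : Fin n → Ω | H * q / 4 ≤ |∑ i, f (y i) - n * p|} with hDdef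
    have hD : μ D ≤ 1 / 2 := by
      refine (measure_sum_deviation_le (hF f hf).1 (hF f hf).2 (by positivity)).trans ?_
      -- The quotient is `16 / H²`, at most 1/4.
      have : (n * p) / (H * q / 4) ^ 2 ≤ 1 / 2 := by
        rw [← hq2, div_le_iff₀ (by positivity)]
        nlinarith [sq_nonneg q]
      refine (ENNReal.ofReal_le_ofReal this).trans ?_
      rw [ENNReal.ofReal_div_of_pos (by norm_num)]
      simp
    have hDm : MeasurableSet D := by
      have hfm := (hF f hf).1
      refine measurableSet_le measurable_const ?_
      have : Measurable fun y : Fin n → Ω => ∑ i, f (y i) - n * p :=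
        (Finset.measurable_sum _ fun i _ => hfm.comp (measurable_pi_apply i)).sub_const _
      exact this.abs
    have hsub : Dᶜ ⊆ Prod.mk x ⁻¹' A := by
      intro y hy
      have hy' : |∑ i, f (y i) - n * p| < H * q / 4 := not_le.1 hy
      refine subset_toMeasurable _ _ ⟨f, hf, ?_⟩
      have h1 : ∀ i, φ.symm (x, y) (.inl i) = x i := fun i => rfl
      have h2 : ∀ i, φ.symm (x, y) (.inr i) = y i := fun i => rfl
      simp only [h1, h2]
      rw [Finset.sum_add_distrib, Finset.sum_sub_distrib]
      rw [← hq2] at hlt hy'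
      exact ghost_deviation hH hq0 (Finset.sum_nonneg fun i _ => ((hF f hf).2 _).1) hlt hy'
    calc (1 / 2 : ENNReal) ≤ 1 - μ D := by
          refine ENNReal.le_sub_of_add_le_left (measure_ne_top _ _) ?_
          calc μ D + 1 / 2 ≤ 1 / 2 + 1 / 2 := by gcongr
            _ = 1 := ENNReal.add_halves 1
      _ = μ Dᶜ := by rw [measure_compl hDm (measure_ne_top _ _), measure_univ]
      _ ≤ _ := measure_mono hsub

/-! ### Choice of constants and conclusion. -/

/-- The 5 comes from `2 ≤ n^d` and `2n² + 1 ≤ n⁴`: the prefactor is at most `n^(5d)`. -/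
lemma two_mul_pow_mul_exp_le {n d : ℕ} (hn : 2 ≤ n) (hd : 1 ≤ d) {δ u : ℝ} (h0 : 0 < δ)
    (h1 : δ < 1) (hu : 5 * (d * Real.log n + Real.log (1 / δ)) ≤ u) :
    2 * ((2 * (n : ℝ) ^ 2 + 1) ^ d * Real.exp (-u)) ≤ δ := by
  have hn' : (2 : ℝ) ≤ n := by exact_mod_cast hn
  have hlog : 0 < Real.log (1 / δ) := Real.log_pos (by rw [lt_div_iff₀ h0]; linarith)
  have hexp : Real.exp (-u) ≤ ((n : ℝ) ^ (5 * d))⁻¹ * δ := by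
    have : ((n : ℝ) ^ (5 * d))⁻¹ * δ = Real.exp (-(5 * (d * Real.log n) + Real.log (1 / δ))) := by
      rw [neg_add, Real.exp_add, one_div, Real.log_inv, neg_neg, Real.exp_log h0, Real.exp_neg]
      have : 5 * (d * Real.log n) = (5 * d : ℕ) * Real.log n := by push_cast; ring
      rw [this, Real.exp_nat_mul, Real.exp_log (by linarith)]
    rw [this]
    exact Real.exp_le_exp.2 (by linarith)
  have h4 : 2 * (n : ℝ) ^ 2 + 1 ≤ n ^ 4 := by
    have : (4 : ℝ) ≤ n ^ 2 := by nlinarith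
    nlinarith
  calc 2 * ((2 * (n : ℝ) ^ 2 + 1) ^ d * Real.exp (-u))
      ≤ (n : ℝ) ^ d * (((n : ℝ) ^ 4) ^ d * (((n : ℝ) ^ (5 * d))⁻¹ * δ)) := by
        have : (2 : ℝ) ≤ (n : ℝ) ^ d := hn'.trans (le_self_pow₀ (by linarith) (by omega))
        gcongr
    _ = δ := by
        have : (n : ℝ) ^ (5 * d) = (n : ℝ) ^ d * ((n : ℝ) ^ 4) ^ d := by
          rw [← pow_mul, ← pow_add]; congr 1; ring
        rw [this]
        field_simp

theorem mainTheorem6 :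
    ∃ K : ℝ, 0 < K ∧
      ∀ (Ω : Type*) [MeasurableSpace Ω] (P : Measure Ω) [IsProbabilityMeasure P]
        (F : Set (Ω → ℝ)) (d : ℕ),
        (∀ f ∈ F, Measurable f ∧ ∀ ω, f ω ∈ Set.Icc (0 : ℝ) 1) →
        IsMeasurableClass P F →
        IsVCSubgraph F d →
        ∀ n : ℕ, 2 ≤ n → ∀ δ : ℝ, 0 < δ →
          ∃ E : Set (Fin n → Ω), MeasurableSet E ∧
            ENNReal.ofReal (1 - δ) ≤ (Measure.pi fun _ : Fin n => P) E ∧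
            ∀ x ∈ E, ∀ f ∈ F,
              1 / ((n : ℝ) * √(∫ ω, f ω ∂P)) * ∑ i, ((∫ ω, f ω ∂P) - f (x i)) ≤
                K * (√((d : ℝ) / n * Real.log n) + √(1 / (n : ℝ) * Real.log (1 / δ))) := by
  -- With `H = 20 r √n` the tail exponent `(H/2)²/8` is `12.5 n r²`, above the required `5 (d log n
  -- + log (1/δ))`.
  refine ⟨20, by norm_num, ?_⟩
  intro Ω _ P _ F d hF hP hd n hn δ hδ
  rcases le_or_gt 1 δ with hδ1 | hδ1
  · refine ⟨∅, MeasurableSet.empty, ?_, fun x hx => hx.elim⟩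
    rw [ENNReal.ofReal_of_nonpos (by linarith)]
    exact zero_le
  have hn' : (2 : ℝ) ≤ n := by exact_mod_cast hn
  have hn0 : (0 : ℝ) < n := by linarith
  have hd1 : 1 ≤ d := one_le_of_vcDimension_eq hd
  have hd' : (1 : ℝ) ≤ d := by exact_mod_cast hd1
  have hlogn : 0.69 ≤ Real.log n :=
    (by linarith [Real.log_two_gt_d9] : (0.69 : ℝ) ≤ Real.log 2).trans
      (Real.log_le_log (by norm_num) hn')
  have hlogδ : 0 < Real.log (1 / δ) := Real.log_pos (by rw [lt_div_iff₀ hδ]; linarith)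
  set r := √((d : ℝ) / n * Real.log n) + √(1 / (n : ℝ) * Real.log (1 / δ)) with hr
  have hr0 : 0 ≤ r := by positivity
  have hr2 : d * Real.log n + Real.log (1 / δ) ≤ n * r ^ 2 := by
    have e1 : √((d : ℝ) / n * Real.log n) ^ 2 = (d : ℝ) / n * Real.log n :=
      Real.sq_sqrt (mul_nonneg (by positivity) (by linarith))
    have e2 : √(1 / (n : ℝ) * Real.log (1 / δ)) ^ 2 = 1 / (n : ℝ) * Real.log (1 / δ) :=
      Real.sq_sqrt (by positivity)
    have e3 : d * Real.log n + Real.log (1 / δ) =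
        n * ((d : ℝ) / n * Real.log n + 1 / (n : ℝ) * Real.log (1 / δ)) := by
      field_simp
    rw [e3, ← e1, ← e2, hr]
    gcongr
    have := mul_nonneg (Real.sqrt_nonneg ((d : ℝ) / n * Real.log n))
      (Real.sqrt_nonneg (1 / (n : ℝ) * Real.log (1 / δ)))
    nlinarith
  -- This lower bound, from `d ≥ 1` and `n ≥ 2`, secures `H² ≥ 64` and `(H/2)² ≥ 2`.
  have hnr : 0.69 ≤ n * r ^ 2 := by nlinarith
  set H := 20 * r * √n with hHdef
  have hH2 : H ^ 2 = 400 * (n * r ^ 2) := by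
    rw [hHdef, mul_pow, Real.sq_sqrt hn0.le]
    ring
  have hHnn : 0 ≤ H := by positivity
  have hH : 0 < H := by
    refine lt_of_le_of_ne hHnn fun h => ?_
    rw [← h] at hH2
    linarith
  obtain ⟨G, hGm, hGle, hG⟩ := exists_measurableSet_deviation (P := P) (n := n) hF hH
    (by rw [hH2]; linarith)
  refine ⟨Gᶜ, hGm.compl, ?_, ?_⟩
  · have hbad := measure_ghostBad_le (P := P) (n := n) (by omega) (fun f hf => (hF f hf).2) hP hd
      (t := H / 2) (by positivity) (by rw [div_pow, hH2]; linarith)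
    have hμG : (Measure.pi fun _ : Fin n => P) G ≤ ENNReal.ofReal δ := by
      calc _ ≤ 2 * ENNReal.ofReal ((2 * n ^ 2 + 1) ^ d * Real.exp (-(H / 2) ^ 2 / 8)) :=
            hGle.trans (by gcongr)
        _ = ENNReal.ofReal (2 * ((2 * n ^ 2 + 1) ^ d * Real.exp (-((H / 2) ^ 2 / 8)))) := by
            rw [ENNReal.ofReal_mul (p := 2) (by norm_num), neg_div]
            simp
        _ ≤ _ := by
            refine ENNReal.ofReal_le_ofReal (two_mul_pow_mul_exp_le hn hd1 hδ hδ1 ?_)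
            rw [div_pow, hH2]
            linarith
    rw [measure_compl hGm (measure_ne_top _ _), measure_univ,
      ENNReal.ofReal_sub _ hδ.le, ENNReal.ofReal_one]
    gcongr
  · intro x hx f hf
    set p := ∫ ω, f ω ∂P with hp
    have hp0 : 0 ≤ p := integral_nonneg fun ω => ((hF f hf).2 ω).1
    rcases hp0.eq_or_lt with h | hpos
    -- When `Pf = 0`, division by zero makes the left side 0.
    · rw [← h]
      simp only [Real.sqrt_zero, mul_zero, div_zero, zero_mul]
      positivity
    · have hdev := hG x hx f hf (by positivity)
      have hsp : 0 < √p := Real.sqrt_pos.2 hpos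
      rw [one_div, ← div_eq_inv_mul, div_le_iff₀ (by positivity), Finset.sum_sub_distrib]
      have e : H * √(n * p) = 20 * r * (n * √p) := by
        rw [Real.sqrt_mul hn0.le, hHdef]
        have := Real.mul_self_sqrt hn0.le
        calc 20 * r * √n * (√n * √p) = 20 * r * ((√n * √n) * √p) := by ring
          _ = _ := by rw [this]
      rw [← hp, e] at hdev
      simp only [Finset.sum_const, Finset.card_univ, Fintype.card_fin, nsmul_eq_mul]
      linarith
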